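/- **Definitions.** A \emph{signature} is a finite set of predicate symbols with arities; the set of \emph{agents} is finite. \emph{Formulas} of first-order epistemic logic are built from atoms $p(x_1,\dots,x_k)$ by $\neg$, $\wedge$, $\forall x$ and a modality $K_a$ for each agent $a$; a formula is \emph{non-modal} if no $K_a$ occurs in it. An \emph{epistemic model} $\mathcal M$ over a non-empty domain $D$ has a set of worlds, an accessibility relation $R_a$ on worlds for each agent $a$, and an interpretation of the predicate symbols in $D$ for each world; $\mathcal M,w\models_v\varphi$, for an assignment $v$ of elements of $D$ to the variables, is defined as usual ($K_a\varphi$ holds at $w$ iff $\varphi$ holds, under the same assignment, at all $u$ with $w R_a u$), and $\mathcal M,w\models\varphi$ means that $\mathcal M,w\models_v\varphi$ for all $v$. An \emph{action model} $\mathcal E$ has a finite non-empty set of events, an accessibility relation on events for each agent, a closed formula $\mathrm{pre}(e)$ for each event $e$, and a formula $\mathrm{post}(e)(p)(x_1,\dots,x_k)$ for each event $e$ and each predicate symbol $p$ of arity $k$. It is \emph{non-modal} if all these formulas are non-modal (they may contain first-order quantifiers). The \emph{product update} $\mathcal M\otimes\mathcal E$ has the same domain; its worlds are the pairs $(w,e)$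 with $\mathcal M,w\models\mathrm{pre}(e)$; $(w,e)$ is related to $(w',e')$ for $a$ iff $w,w'$ and $e,e'$ are both related for $a$; and $p$ is interpreted at $(w,e)$ by the tuples that satisfy $\mathrm{post}(e)(p)$ at $w$ in $\mathcal M$. Put $\mathcal M_0=\mathcal M$ and $\mathcal M_{n+1}=\mathcal M_n\otimes\mathcal E$. The \emph{model of histories} $\mathcal M\mathcal E^*$ is the disjoint union of the $\mathcal M_n$, $n\ge 0$; a \emph{history starting from} $w$ is a world $(\cdots((w,e_1),e_2)\cdots,e_n)$ of it. An \emph{automatic} epistemic model has finitely many worlds and is given by finite automata: one for its (possibly infinite) domain, a regular language over a finite alphabet, and, for each world and each predicate symbol of arity $k$, one that reads $k$-tuples of domain words synchronously, padded at the end to equal length, and recognizes the interpretation of that symbol in that world. The \emph{epistemic planning problem with non-modal action models} ($\mathrm{EPP}_{nm}$) is the following decision problem. Input: a signature, a finite set of agents, an automatic epistemic model $\mathcal M$ (given by its automata), a world $w$ of $\mathcal M$, a non-modal action model $\mathcal E$, and a formula $\varphi_g$ of first-order epistemic logic. Question: is there a history $h$ starting from $w$ with $\mathcal M\mathcal E^*,h\models\varphi_g$?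 **Theorem.** $\mathrm{EPP}_{nm}$ is undecidable: no algorithm halts with the correct answer on every input. It remains undecidable when the signature is fixed to consist of one binary and two unary predicate symbols and there is exactly one agent. -/

import Mathlib

namespace EPP

/-! ## First-order epistemic logic -/

/-- A finite relational signature: finitely many predicate symbols, each with an arity. -/
structure Signature where
  numPreds : ℕ
  arity : Fin numPreds → ℕ

/-- Formulas of first-order epistemic logic over the signature `σ`, for the agents `Fin m`.
The variables are the natural numbers. -/
inductive Formula (σ : Signature) (m : ℕ) : Type
  | atom (p : Fin σ.numPreds) (xs : Fin (σ.arity p) → ℕ) : Formula σ m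
  | neg (φ : Formula σ m) : Formula σ m
  | and (φ ψ : Formula σ m) : Formula σ m
  | all (x : ℕ) (φ : Formula σ m) : Formula σ m
  | box (a : Fin m) (φ : Formula σ m) : Formula σ m

namespace Formula

variable {σ : Signature} {m : ℕ}

/-- The set of free variables of a formula. -/
def freeVars : Formula σ m → Set ℕ
  | atom _ xs => Set.range xs
  | neg φ => φ.freeVars
  | and φ ψ => φ.freeVars ∪ ψ.freeVars
  | all x φ => φ.freeVars \ {x}
  | box _ φ => φ.freeVars

/-- Pure first-order formulas: no epistemic modality occurs. -/
def NonModal : Formula σ m → Prop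
  | atom _ _ => True
  | neg φ => φ.NonModal
  | and φ ψ => φ.NonModal ∧ ψ.NonModal
  | all _ φ => φ.NonModal
  | box _ _ => False

end Formula

/-- First-order epistemic models over the domain `D`. All worlds share the domain `D`; the
predicates are interpreted world by world. Non-emptiness of the set of worlds is not a field, since
a product update may have no world; every model that occurs as an input has one. -/
structure EpistemicModel (σ : Signature) (m : ℕ) (D : Type) where
  World : Type
  rel : Fin m → World → World → Prop
  interp : World → (p : Fin σ.numPreds) → (Fin (σ.arity p) → D) → Prop

namespace EpistemicModel

variable {σ : Signature} {m : ℕ} {D : Type}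

/-- Satisfaction of a formula at a world under an assignment of the variables. -/
def Sat (M : EpistemicModel σ m D) : M.World → (ℕ → D) → Formula σ m → Prop
  | w, v, .atom p xs => M.interp w p fun j => v (xs j)
  | w, v, .neg φ => ¬ M.Sat w v φ
  | w, v, .and φ ψ => M.Sat w v φ ∧ M.Sat w v ψ
  | w, v, .all x φ => ∀ d : D, M.Sat w (Function.update v x d) φ
  | w, v, .box a φ => ∀ u : M.World, M.rel a w u → M.Sat u v φ

/-- Satisfaction at a world under every assignment. -/
def Holds (M : EpistemicModel σ m D) (w : M.World) (φ : Formula σ m) : Prop :=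
  ∀ v : ℕ → D, M.Sat w v φ

end EpistemicModel

/-! ## Action models, updates and histories -/

/-- Action models: finitely many (and at least one) events. The postcondition of an event for a
predicate of arity `k` is a formula whose free variables are among the variables `0, …, k - 1`,
which stand for the arguments of the predicate. -/
structure ActionModel (σ : Signature) (m : ℕ) where
  numEvents : ℕ
  numEvents_pos : 0 < numEvents
  rel : Fin m → Fin numEvents → Fin numEvents → Bool
  pre : Fin numEvents → Formula σ m
  post : Fin numEvents → Fin σ.numPreds → Formula σ m
  pre_closed : ∀ e, (pre e).freeVars = ∅
  post_freeVars : ∀ e p, (post e p).freeVars ⊆ {x | x < σ.arity p}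

/-- Non-modal action models: all pre- and postconditions are pure first-order formulas. -/
def ActionModel.NonModal {σ : Signature} {m : ℕ} (E : ActionModel σ m) : Prop :=
  (∀ e, (E.pre e).NonModal) ∧ ∀ e p, (E.post e p).NonModal

namespace EpistemicModel

variable {σ : Signature} {m : ℕ} {D : Type}

/-- The product update of an epistemic model with an action model. -/
def update (M : EpistemicModel σ m D) (E : ActionModel σ m) : EpistemicModel σ m D where
  World := {x : M.World × Fin E.numEvents // M.Holds x.1 (E.pre x.2)}
  rel a x y := M.rel a x.1.1 y.1.1 ∧ E.rel a x.1.2 y.1.2 = true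
  interp x p d := ∀ v : ℕ → D, (∀ j : Fin (σ.arity p), v j = d j) →
    M.Sat x.1.1 v (E.post x.1.2 p)

/-- The `n`-th iterated update. -/
def iter (M : EpistemicModel σ m D) (E : ActionModel σ m) : ℕ → EpistemicModel σ m D
  | 0 => M
  | n + 1 => (M.iter E n).update E

/-- The world of `M` from which a world of the `n`-th update starts. -/
def root (M : EpistemicModel σ m D) (E : ActionModel σ m) :
    (n : ℕ) → (M.iter E n).World → M.World
  | 0, w => w
  | n + 1, h => root M E n h.1.1

/-- The epistemic model of histories: the disjoint union of all the iterated updates. -/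
def histories (M : EpistemicModel σ m D) (E : ActionModel σ m) : EpistemicModel σ m D where
  World := Σ n : ℕ, (M.iter E n).World
  rel a h h' := ∃ (n : ℕ) (u u' : (M.iter E n).World),
    h = ⟨n, u⟩ ∧ h' = ⟨n, u'⟩ ∧ (M.iter E n).rel a u u'
  interp h p d := (M.iter E h.1).interp h.2 p d

/-- The history `h` starts from the world `w`. -/
def StartsFrom (M : EpistemicModel σ m D) (E : ActionModel σ m)
    (h : (M.histories E).World) (w : M.World) : Prop :=
  M.root E h.1 h.2 = w

end EpistemicModel

/-! ## Automatic presentations -/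

/-- Nondeterministic finite automata over the alphabet `α`, as finite data. -/
structure Automaton (α : Type) where
  numStates : ℕ
  start : List (Fin numStates)
  accept : List (Fin numStates)
  trans : List (Fin numStates × α × Fin numStates)

/-- The corresponding nondeterministic automaton of Mathlib. -/
def Automaton.toNFA {α : Type} (A : Automaton α) : NFA α (Fin A.numStates) where
  step q c := {q' | (q, c, q') ∈ A.trans}
  start := {q | q ∈ A.start}
  accept := {q | q ∈ A.accept}

/-- The language recognized by a finite automaton. -/
def Automaton.language {α : Type} (A : Automaton α) : Language α :=
  A.toNFA.accepts

/-- The convolution of a tuple of words: the words are written on parallel tracks, and the shorter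
ones are padded at the end with `none` up to the length of the longest one. -/
def convolution {k : ℕ} {α : Type} (u : Fin k → List α) : List (Fin k → Option α) :=
  (List.range (Finset.univ.sup fun j => (u j).length)).map fun i j => (u j)[i]?

/-- Automatic presentations of epistemic models with finitely many worlds: an automaton for the
common domain, and, for each world, one automaton for each predicate. -/
structure AutomaticPresentation (σ : Signature) (m : ℕ) where
  alphabetSize : ℕ
  numWorlds : ℕ
  rel : Fin m → Fin numWorlds → Fin numWorlds → Bool
  domAut : Automaton (Fin alphabetSize)
  predAut : Fin numWorlds → (p : Fin σ.numPreds) →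
    Automaton (Fin (σ.arity p) → Option (Fin alphabetSize))
  domain_nonempty : ∃ u, u ∈ domAut.language

/-- The domain denoted by an automatic presentation. -/
def AutomaticPresentation.Domain {σ : Signature} {m : ℕ} (P : AutomaticPresentation σ m) : Type :=
  {u : List (Fin P.alphabetSize) // u ∈ P.domAut.language}

/-- The automatic epistemic model denoted by an automatic presentation. -/
def AutomaticPresentation.model {σ : Signature} {m : ℕ} (P : AutomaticPresentation σ m) :
    EpistemicModel σ m P.Domain where
  World := Fin P.numWorlds
  rel a w u := P.rel a w u = true
  interp w p d := convolution (fun j => (d j).1) ∈ (P.predAut w p).language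

/-! ## The epistemic planning problem -/

/-- Instances of the epistemic planning problem: a finite signature, a finite number of agents, an
automatic epistemic model given by a presentation, a distinguished world in it, an action model and
a goal formula. -/
structure Instance where
  sig : Signature
  numAgents : ℕ
  pres : AutomaticPresentation sig numAgents
  action : ActionModel sig numAgents
  world : Fin pres.numWorlds
  goal : Formula sig numAgents

/-- The answer to the instance is "yes": some history that starts from the distinguished world
satisfies the goal formula in the epistemic model of histories. -/
def Instance.IsPositive (I : Instance) : Prop :=
  ∃ h : (I.pres.model.histories I.action).World,
    I.pres.model.StartsFrom I.action h I.world ∧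
      (I.pres.model.histories I.action).Holds h I.goal

/-! ## Coding of instances by natural numbers -/

/-- The code of a finite table of natural numbers. -/
def tableCode {n : ℕ} (f : Fin n → ℕ) : ℕ := Encodable.encode (List.ofFn f)

def Signature.code (σ : Signature) : ℕ := tableCode σ.arity

def Formula.code {σ : Signature} {m : ℕ} : Formula σ m → ℕ
  | atom p xs => Nat.pair 0 (Nat.pair p (tableCode xs))
  | neg φ => Nat.pair 1 φ.code
  | and φ ψ => Nat.pair 2 (Nat.pair φ.code ψ.code)
  | all x φ => Nat.pair 3 (Nat.pair x φ.code)
  | box a φ => Nat.pair 4 (Nat.pair a φ.code)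

/-- The code of the accessibility relations of finitely many agents on a finite set. -/
def relCode {m n : ℕ} (r : Fin m → Fin n → Fin n → Bool) : ℕ :=
  tableCode fun a => tableCode fun i => tableCode fun j => (r a i j).toNat

/-- The code of an automaton, for a given coding `c` of its letters. -/
def Automaton.code {α : Type} (c : α → ℕ) (A : Automaton α) : ℕ :=
  Encodable.encode (A.numStates, A.start.map Fin.val, A.accept.map Fin.val,
    A.trans.map fun t => (t.1.val, c t.2.1, t.2.2.val))

/-- The code of a letter of a padded alphabet; the padding symbol has code `0`. -/
def letterCode {k s : ℕ} (l : Fin k → Option (Fin s)) : ℕ :=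
  tableCode fun j => match l j with
    | none => 0
    | some b => b.val + 1

def AutomaticPresentation.code {σ : Signature} {m : ℕ} (P : AutomaticPresentation σ m) : ℕ :=
  Encodable.encode (P.alphabetSize, P.numWorlds, relCode P.rel, P.domAut.code Fin.val,
    tableCode fun w => tableCode fun p => (P.predAut w p).code letterCode)

def ActionModel.code {σ : Signature} {m : ℕ} (E : ActionModel σ m) : ℕ :=
  Encodable.encode (E.numEvents, relCode E.rel, tableCode (fun e => (E.pre e).code),
    tableCode fun e => tableCode fun p => (E.post e p).code)

/-- The code of an instance. -/
def Instance.code (I : Instance) : ℕ :=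
  Encodable.encode (I.sig.code, I.numAgents, I.pres.code, I.action.code, I.world.val, I.goal.code)

/-! The coding is injective. -/

theorem tableCode_injective {n : ℕ} : Function.Injective (tableCode (n := n)) := fun _ _ h =>
  List.ofFn_injective (Encodable.encode_injective h)

theorem Signature.code_injective : Function.Injective Signature.code := by
  rintro ⟨n, f⟩ ⟨n', f'⟩ h
  have h : List.ofFn f = List.ofFn f' := Encodable.encode_injective h
  have hn : n = n' := by simpa using congrArg List.length h
  subst hn
  rw [List.ofFn_injective h]

theorem Formula.code_injective {σ : Signature} {m : ℕ} :
    Function.Injective (Formula.code (σ := σ) (m := m)) := by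
  intro φ
  induction φ with
  | atom p xs =>
    rintro (⟨q, ys⟩ | _ | _ | _ | _) h <;> simp [code, Nat.pair_eq_pair] at h
    obtain ⟨h1, h2⟩ := h
    obtain rfl := Fin.ext h1
    rw [tableCode_injective h2]
  | neg φ ih =>
    rintro (_ | _ | _ | _ | _) h <;> simp [code, Nat.pair_eq_pair] at h
    rw [ih h]
  | and φ ψ ih1 ih2 =>
    rintro (_ | _ | _ | _ | _) h <;> simp [code, Nat.pair_eq_pair] at h
    rw [ih1 h.1, ih2 h.2]
  | all x φ ih =>
    rintro (_ | _ | _ | _ | _) h <;> simp [code, Nat.pair_eq_pair] at h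
    rw [h.1, ih h.2]
  | box a φ ih =>
    rintro (_ | _ | _ | _ | _) h <;> simp [code, Nat.pair_eq_pair] at h
    rw [Fin.ext h.1, ih h.2]

theorem relCode_injective {m n : ℕ} : Function.Injective (relCode (m := m) (n := n)) := by
  intro r r' h
  funext a i j
  have h1 := congrFun (tableCode_injective h) a
  have h2 := congrFun (tableCode_injective h1) i
  have h3 := congrFun (tableCode_injective h2) j
  revert h3
  cases r a i j <;> cases r' a i j <;> simp

theorem Automaton.code_injective {α : Type} {c : α → ℕ} (hc : Function.Injective c) :
    Function.Injective (Automaton.code c) := by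
  rintro ⟨n, s, a, t⟩ ⟨n', s', a', t'⟩ h
  have h := Encodable.encode_injective h
  simp only [Prod.mk.injEq] at h
  obtain ⟨rfl, h1, h2, h3⟩ := h
  have hinj : Function.Injective
      fun t : Fin n × α × Fin n => (t.1.val, c t.2.1, t.2.2.val) := by
    rintro ⟨x, y, z⟩ ⟨x', y', z'⟩ hh
    simp only [Prod.mk.injEq] at hh
    rw [Fin.ext hh.1, hc hh.2.1, Fin.ext hh.2.2]
  have h3 := List.map_injective_iff.2 hinj h3
  rw [List.map_injective_iff.2 Fin.val_injective h1,
    List.map_injective_iff.2 Fin.val_injective h2, h3]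

theorem letterCode_injective {k s : ℕ} : Function.Injective (letterCode (k := k) (s := s)) := by
  intro l l' h
  funext j
  have h1 := congrFun (tableCode_injective h) j
  revert h1
  rcases l j with _ | b <;> rcases l' j with _ | b' <;> simp [Fin.ext_iff]

theorem AutomaticPresentation.code_injective {σ : Signature} {m : ℕ} :
    Function.Injective (AutomaticPresentation.code (σ := σ) (m := m)) := by
  rintro ⟨s, n, r, d, q, _⟩ ⟨s', n', r', d', q', _⟩ h
  have h := Encodable.encode_injective h
  simp only [Prod.mk.injEq] at h
  obtain ⟨rfl, rfl, h1, h2, h3⟩ := h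
  obtain rfl := relCode_injective h1
  obtain rfl := Automaton.code_injective Fin.val_injective h2
  have hq : q = q' := by
    funext w p
    have h4 := congrFun (tableCode_injective h3) w
    exact Automaton.code_injective letterCode_injective (congrFun (tableCode_injective h4) p)
  subst hq
  rfl

theorem ActionModel.code_injective {σ : Signature} {m : ℕ} :
    Function.Injective (ActionModel.code (σ := σ) (m := m)) := by
  rintro ⟨n, _, r, pr, po, _, _⟩ ⟨n', _, r', pr', po', _, _⟩ h
  have h := Encodable.encode_injective h
  simp only [Prod.mk.injEq] at h
  obtain ⟨rfl, h1, h2, h3⟩ := h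
  obtain rfl := relCode_injective h1
  have hpr : pr = pr' := by
    funext e
    exact Formula.code_injective (congrFun (tableCode_injective h2) e)
  have hpo : po = po' := by
    funext e p
    have h4 := congrFun (tableCode_injective h3) e
    exact Formula.code_injective (congrFun (tableCode_injective h4) p)
  subst hpr hpo
  rfl

theorem Instance.code_injective : Function.Injective Instance.code := by
  rintro ⟨σ, m, P, E, w, g⟩ ⟨σ', m', P', E', w', g'⟩ h
  have h := Encodable.encode_injective h
  simp only [Prod.mk.injEq] at h
  obtain ⟨h0, rfl, h1, h2, h3, h4⟩ := h
  obtain rfl := Signature.code_injective h0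
  obtain rfl := AutomaticPresentation.code_injective h1
  obtain rfl := ActionModel.code_injective h2
  obtain rfl := Fin.ext h3
  obtain rfl := Formula.code_injective h4
  rfl

/-! ## Decidability -/

/-- The epistemic planning problem is decidable on the class `C` of instances: some algorithm (a
partial recursive function) halts with the right answer on the code of every instance in `C`. There
is no requirement on other inputs. -/
def DecidableOn (C : Set Instance) : Prop :=
  ∃ f : ℕ →. Bool, Partrec f ∧
    ∀ I ∈ C, (I.IsPositive → true ∈ f I.code) ∧ (¬ I.IsPositive → false ∈ f I.code)

/-- The instances with a non-modal action model, without any restriction on the postconditions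
apart from being pure first-order. -/
def nonModalInstances : Set Instance := {I | I.action.NonModal}

/-- The signature that consists of one binary and two unary predicate symbols. -/
def graphSignature : Signature := ⟨3, ![2, 1, 1]⟩

end EPP

/-!
The halting problem is reduced to epistemic planning with one world, one event and one agent.

Evaluation of partial recursive functions is inductively definable: the statements "the first
component of `x` is `a`", "the second component of `x` is `b`" and "the program and input coded by
`x` yield `m`" are generated by finitely many rules, and each rule is a first-order formula over the
order of the natural numbers and the facts derived before. Applying all rules once is therefore a
first-order definable update, which the postcondition of a single event performs
(`Represents.update`). After `N` occurrences of the event the model records exactly the facts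
`Facts.stage N` derivable in `N` rounds (`Represents.iter`). Derived facts are true
(`Facts.sound_stage`), and every true value of a program is eventually derived
(`eventually_app_of_mem_eval`, by induction on the program).

One binary and two unary predicates suffice for this, because the domain consists of four copies of
the natural numbers, the tracks, which the unary predicates tell apart. The edges within track `0`
are the order, the edges from another track to track `0` link copies of the same number, and the
edges from track `0` to the other tracks hold the three relations that are being generated. At the
start the latter are empty, and the model is automatic (`represents_trackPresentation`).

The only part of the planning problem that depends on the input is the goal formula `hasValue k`,
which says that a value has been derived for the number `k`. Its code is a primitive recursive
function of `k`. If `k` codes a program and an input then the problem is solvable if and only if the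
program halts on the input (`isPositive_valueInstance`, `exists_stage_iff`), which is undecidable for
a suitable fixed program.
-/

namespace EPP

open Nat.Partrec (Code)

/-! ### Inductive rules for unpairing and evaluation -/

/-- Three binary relations on `ℕ`, thought of as sets of facts derived so far: `F 0 x a` says that
`x` has first component `a`, `F 1 x b` says that `x` has second component `b`, and `F 2 x m` says
that the program and input coded by `x` yield the value `m`. -/
abbrev Facts := Fin 3 → ℕ → ℕ → Prop

namespace Facts

/-- The facts record that `x` is the pair of `a` and `b`. -/
def IsPair (F : Facts) (x a b : ℕ) : Prop := F 0 x a ∧ F 1 x b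

/-- The facts record that the program `c` on input `n` yields `m`. -/
def App (F : Facts) (c n m : ℕ) : Prop := ∃ x, F.IsPair x c n ∧ F 2 x m

/-- The facts record that the predecessor of `x` is the pair of `a` and `b`. -/
def PredIsPair (F : Facts) (x a b : ℕ) : Prop := ∃ y, x = y + 1 ∧ F.IsPair y a b

/-- One application of the rule for first components; it walks along the square shells that
`Nat.pair` enumerates. -/
def fstRule (F : Facts) (x a : ℕ) : Prop :=
  (x = 0 ∧ a = 0) ∨ ∃ a' b', F.PredIsPair x a' b' ∧
    ((a' < b' ∧ a = a' + 1) ∨ (b' < a' ∧ a = a') ∨ (a' = b' ∧ a = 0))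

/-- One application of the rule for second components. -/
def sndRule (F : Facts) (x b : ℕ) : Prop :=
  (x = 0 ∧ b = 0) ∨ ∃ a' b', F.PredIsPair x a' b' ∧
    ((a' < b' ∧ ((b' = a' + 1 ∧ b = 0) ∨ (b' ≠ a' + 1 ∧ b = b'))) ∨ (¬ a' < b' ∧ b = b' + 1))

/-- The rule for a pairing program with parts `f` and `g`. -/
def pairClause (F : Facts) (f g n m : ℕ) : Prop :=
  ∃ a b, F.App f n a ∧ F.App g n b ∧ F.IsPair m a b

/-- The rule for the composition of `f` with `g`. -/
def compClause (F : Facts) (f g n m : ℕ) : Prop :=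
  ∃ a, F.App g n a ∧ F.App f a m

/-- The rule for the primitive recursion `c` with base `f` and step `g`. -/
def precClause (F : Facts) (c f g n m : ℕ) : Prop :=
  ∃ a k, F.IsPair n a k ∧ ((k = 0 ∧ F.App f a m) ∨
    ∃ j, k = j + 1 ∧ ∃ p i, F.IsPair p a j ∧ F.App c p i ∧
      ∃ q r, F.IsPair q j i ∧ F.IsPair r a q ∧ F.App g r m)

/-- The rule for the unbounded search `c` for a zero of `f`. -/
def rfindClause (F : Facts) (c f n m : ℕ) : Prop :=
  ∃ a k s, F.IsPair n a k ∧ F.App f n s ∧ ((s = 0 ∧ m = k) ∨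
    (s ≠ 0 ∧ ∃ j p, j = k + 1 ∧ F.IsPair p a j ∧ F.App c p m))

/-- One application of the evaluation rules. A program is coded as a tag `t` paired with a pair
`(f, g)` of subprograms; the tags `0, …, 7` name the constructors of `Nat.Partrec.Code`. -/
def evalRule (F : Facts) (x m : ℕ) : Prop :=
  ∃ c n t d f g, F.IsPair x c n ∧ F.IsPair c t d ∧ F.IsPair d f g ∧
    ((t = 0 ∧ m = 0) ∨ (t = 1 ∧ m = n + 1) ∨ (t = 2 ∧ F 0 n m) ∨ (t = 3 ∧ F 1 n m) ∨
      (t = 4 ∧ F.pairClause f g n m) ∨ (t = 5 ∧ F.compClause f g n m) ∨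
      (t = 6 ∧ F.precClause c f g n m) ∨ (t = 7 ∧ F.rfindClause c f n m))

/-- The facts that follow from `F` by one application of a rule. -/
def step (F : Facts) : Facts := ![F.fstRule, F.sndRule, F.evalRule]

/-- The facts obtained from no facts by `N` simultaneous applications of all rules. A round does not
retain the facts of the previous one: a fact stays because it is derived again. -/
def stage : ℕ → Facts
  | 0 => fun _ _ _ => False
  | N + 1 => (stage N).step

end Facts

/-- The code of a program: a tag for its outermost constructor, paired with the codes of its parts,
where `0` stands for a missing part. -/
def progCode : Code → ℕ
  | .zero => Nat.pair 0 (Nat.pair 0 0)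
  | .succ => Nat.pair 1 (Nat.pair 0 0)
  | .left => Nat.pair 2 (Nat.pair 0 0)
  | .right => Nat.pair 3 (Nat.pair 0 0)
  | .pair f g => Nat.pair 4 (Nat.pair (progCode f) (progCode g))
  | .comp f g => Nat.pair 5 (Nat.pair (progCode f) (progCode g))
  | .prec f g => Nat.pair 6 (Nat.pair (progCode f) (progCode g))
  | .rfind' f => Nat.pair 7 (Nat.pair (progCode f) 0)

/-- The pair that follows a given one in the enumeration of all pairs along square shells. -/
theorem unpair_succ (x : ℕ) : Nat.unpair (x + 1) =
    if x.unpair.1 < x.unpair.2 then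
      (x.unpair.1 + 1, if x.unpair.2 = x.unpair.1 + 1 then 0 else x.unpair.2)
    else (if x.unpair.2 < x.unpair.1 then x.unpair.1 else 0, x.unpair.2 + 1) := by
  obtain ⟨a, b, rfl⟩ : ∃ a b, x = Nat.pair a b := ⟨_, _, (Nat.pair_unpair x).symm⟩
  rw [Nat.unpair_pair]
  dsimp only
  have key : ∀ c d, Nat.pair a b + 1 = Nat.pair c d → Nat.unpair (Nat.pair a b + 1) = (c, d) := by
    intro c d h
    rw [h, Nat.unpair_pair]
  split_ifs with h1 h2 h3 <;> apply key <;> unfold Nat.pair <;> split_ifs <;> try omega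
  · subst h2
    ring
  · obtain rfl : a = b := by omega
    ring

section Evaluation

variable {f g : Code} {a k m n : ℕ}

theorem mem_eval_pair :
    m ∈ (Code.pair f g).eval n ↔ ∃ a ∈ f.eval n, ∃ b ∈ g.eval n, m = Nat.pair a b := by
  simp [Code.eval, Seq.seq, eq_comm]

theorem mem_eval_comp : m ∈ (Code.comp f g).eval n ↔ ∃ a ∈ g.eval n, m ∈ f.eval a := by
  exact Part.mem_bind_iff

theorem mem_eval_prec_succ : m ∈ (Code.prec f g).eval (Nat.pair a (k + 1)) ↔
    ∃ i ∈ (Code.prec f g).eval (Nat.pair a k), m ∈ g.eval (Nat.pair a (Nat.pair k i)) := by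
  rw [← Nat.succ_eq_add_one, Code.eval_prec_succ]
  simp

theorem mem_eval_rfind_iff : m ∈ (Code.rfind' f).eval (Nat.pair a k) ↔
    ∃ r, 0 ∈ f.eval (Nat.pair a (r + k)) ∧
      (∀ j < r, ∃ s ∈ f.eval (Nat.pair a (j + k)), s ≠ 0) ∧ r + k = m := by
  have h : (Code.rfind' f).eval (Nat.pair a k) =
      (Nat.rfind fun n => (fun m => decide (m = 0)) <$> f.eval (Nat.pair a (n + k))).map (· + k) := by
    rw [Code.eval, Nat.unpaired, Nat.unpair_pair]
  rw [h, Part.mem_map_iff]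
  refine exists_congr fun r => ?_
  refine (and_congr_left' (Nat.mem_rfind.trans (and_congr ?_ ?_))).trans and_assoc
  · simp
  · simp

/-- An unbounded search either succeeds at once or continues as a search from the next number. -/
theorem mem_eval_rfind : m ∈ (Code.rfind' f).eval (Nat.pair a k) ↔
    ∃ s ∈ f.eval (Nat.pair a k),
      (s = 0 ∧ m = k) ∨ (s ≠ 0 ∧ m ∈ (Code.rfind' f).eval (Nat.pair a (k + 1))) := by
  simp only [mem_eval_rfind_iff]
  constructor
  · rintro ⟨_ | r, hr, hlt, rfl⟩
    · exact ⟨0, by simpa using hr, .inl (by simp)⟩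
    · obtain ⟨s, hs, hs0⟩ := hlt 0 (Nat.succ_pos r)
      refine ⟨s, by simpa using hs, .inr ⟨hs0, r, ?_, fun j hj => ?_, by omega⟩⟩
      · rwa [show r + (k + 1) = r + 1 + k by omega]
      · rw [show j + (k + 1) = j + 1 + k by omega]
        exact hlt _ (Nat.succ_lt_succ hj)
  · rintro ⟨s, hs, ⟨rfl, rfl⟩ | ⟨hs0, r, hr, hlt, rfl⟩⟩
    · exact ⟨0, by simpa using hs, by simp⟩
    · refine ⟨r + 1, ?_, fun j hj => ?_, by omega⟩
      · rwa [show r + 1 + k = r + (k + 1) by omega]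
      · rcases j with _ | j
        · exact ⟨s, by simpa using hs, hs0⟩
        · rw [show j + 1 + k = j + (k + 1) by omega]
          exact hlt j (Nat.lt_of_succ_lt_succ hj)

theorem le_of_mem_eval_rfind (h : m ∈ (Code.rfind' f).eval (Nat.pair a k)) : k ≤ m := by
  obtain ⟨r, -, -, rfl⟩ := mem_eval_rfind_iff.1 h
  exact Nat.le_add_left k r

end Evaluation

/-! ### Soundness of the rules -/

/-- Every recorded fact is true. Nothing is required of evaluation facts for numbers that do not
code a program. -/
structure Facts.Sound (F : Facts) : Prop where
  fst : ∀ x a, F 0 x a → a = x.unpair.1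
  snd : ∀ x b, F 1 x b → b = x.unpair.2
  eval : ∀ x m, F 2 x m → ∀ c n, x = Nat.pair (progCode c) n → m ∈ c.eval n

namespace Facts.Sound

variable {F : Facts}

theorem isPair (hF : F.Sound) {x a b : ℕ} (h : F.IsPair x a b) : x = Nat.pair a b := by
  rw [hF.fst _ _ h.1, hF.snd _ _ h.2, Nat.pair_unpair]

theorem app (hF : F.Sound) {c : Code} {n m : ℕ} (h : F.App (progCode c) n m) : m ∈ c.eval n := by
  obtain ⟨x, hx, h⟩ := h
  exact hF.eval _ _ h _ _ (hF.isPair hx)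

theorem evalRule (hF : F.Sound) {c : Code} {n m : ℕ}
    (h : F.evalRule (Nat.pair (progCode c) n) m) : m ∈ c.eval n := by
  obtain ⟨c', n', t, d, f, g, hx, hc, hd, h⟩ := h
  obtain ⟨rfl, rfl⟩ := Nat.pair_eq_pair.1 (hF.isPair hx)
  have hc := hF.isPair hc
  obtain rfl := hF.isPair hd
  cases c <;> simp only [progCode] at hc <;> obtain ⟨rfl, hd⟩ := Nat.pair_eq_pair.1 hc <;>
    obtain ⟨rfl, rfl⟩ := Nat.pair_eq_pair.1 hd <;> simp at h
  case zero => simp [Code.eval, h, pure, PFun.pure]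
  case succ => simp [Code.eval, h]
  case left => simp [Code.eval, hF.fst _ _ h]
  case right => simp [Code.eval, hF.snd _ _ h]
  case pair =>
    obtain ⟨a, b, hf, hg, hm⟩ := h
    exact mem_eval_pair.2 ⟨a, hF.app hf, b, hF.app hg, hF.isPair hm⟩
  case comp =>
    obtain ⟨a, hg, hf⟩ := h
    exact mem_eval_comp.2 ⟨a, hF.app hg, hF.app hf⟩
  case prec =>
    obtain ⟨a, k, hn, h⟩ := h
    obtain rfl := hF.isPair hn
    rcases h with ⟨rfl, h⟩ | ⟨j, rfl, p, i, hp, hi, q, r, hq, hr, h⟩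
    · rw [Code.eval_prec_zero]
      exact hF.app h
    · obtain rfl := hF.isPair hp
      obtain rfl := hF.isPair hq
      obtain rfl := hF.isPair hr
      exact mem_eval_prec_succ.2 ⟨i, hF.app (c := .prec _ _) hi, hF.app h⟩
  case rfind' =>
    obtain ⟨a, k, s, hn, hs, h⟩ := h
    obtain rfl := hF.isPair hn
    refine mem_eval_rfind.2 ⟨s, hF.app hs, ?_⟩
    rcases h with h | ⟨h0, j, p, rfl, hp, h⟩
    · exact .inl h
    · obtain rfl := hF.isPair hp
      exact .inr ⟨h0, hF.app (c := .rfind' _) h⟩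

theorem step (hF : F.Sound) : F.step.Sound where
  fst x a h := by
    rcases h with ⟨rfl, rfl⟩ | ⟨a', b', ⟨y, rfl, hy⟩, h⟩
    · simp
    · rw [unpair_succ, ← hF.fst _ _ hy.1, ← hF.snd _ _ hy.2]
      split_ifs <;> simp <;> omega
  snd x b h := by
    rcases h with ⟨rfl, rfl⟩ | ⟨a', b', ⟨y, rfl, hy⟩, h⟩
    · simp
    · rw [unpair_succ, ← hF.fst _ _ hy.1, ← hF.snd _ _ hy.2]
      split_ifs <;> simp <;> omega
  eval x m h c n hx := by
    subst hx
    exact hF.evalRule h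

end Facts.Sound

theorem Facts.sound_stage (N : ℕ) : (Facts.stage N).Sound := by
  induction N with
  | zero => exact ⟨fun _ _ => False.elim, fun _ _ => False.elim, fun _ _ => False.elim⟩
  | succ N ih => exact ih.step

/-! ### Completeness of the rules -/

section Completeness

open Filter Facts

/-- A fact whose premises are eventually recorded is itself eventually recorded, one round later. -/
theorem eventually_of_succ {p : ℕ → Prop} (h : ∀ᶠ N in atTop, p (N + 1)) :
    ∀ᶠ N in atTop, p N := by
  rw [← map_add_atTop_eq_nat 1]
  exact h

theorem eventually_isPair (x : ℕ) :
    ∀ᶠ N in atTop, (stage N).IsPair x x.unpair.1 x.unpair.2 := by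
  induction x with
  | zero => exact eventually_of_succ (.of_forall fun N => ⟨.inl (by simp), .inl (by simp)⟩)
  | succ x ih =>
    refine eventually_of_succ ?_
    filter_upwards [ih] with N hN
    refine ⟨.inr ⟨_, _, ⟨x, rfl, hN⟩, ?_⟩, .inr ⟨_, _, ⟨x, rfl, hN⟩, ?_⟩⟩
    all_goals
      rw [unpair_succ]
      split_ifs <;> simp <;> omega

theorem eventually_pair (a b : ℕ) : ∀ᶠ N in atTop, (stage N).IsPair (Nat.pair a b) a b := by
  simpa using eventually_isPair (Nat.pair a b)

theorem eventually_app {c n m : ℕ} (h : ∀ᶠ N in atTop, stage N 2 (Nat.pair c n) m) :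
    ∀ᶠ N in atTop, (stage N).App c n m := by
  filter_upwards [h, eventually_pair c n] with N h1 h2
  exact ⟨_, h2, h1⟩

/-- To derive an evaluation fact eventually it suffices to derive eventually the premises of the
rule for the outermost constructor. -/
theorem eventually_eval {t f g n m : ℕ}
    (h : ∀ᶠ N in atTop,
      ((t = 0 ∧ m = 0) ∨ (t = 1 ∧ m = n + 1) ∨ (t = 2 ∧ stage N 0 n m) ∨ (t = 3 ∧ stage N 1 n m) ∨
      (t = 4 ∧ (stage N).pairClause f g n m) ∨ (t = 5 ∧ (stage N).compClause f g n m) ∨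
      (t = 6 ∧ (stage N).precClause (Nat.pair t (Nat.pair f g)) f g n m) ∨
      (t = 7 ∧ (stage N).rfindClause (Nat.pair t (Nat.pair f g)) f n m))) :
    ∀ᶠ N in atTop, (stage N).App (Nat.pair t (Nat.pair f g)) n m := by
  refine eventually_app (eventually_of_succ ?_)
  filter_upwards [h, eventually_pair (Nat.pair t (Nat.pair f g)) n, eventually_pair t (Nat.pair f g),
    eventually_pair f g] with N h h1 h2 h3
  exact ⟨_, _, _, _, _, _, h1, h2, h3, h⟩

theorem eventually_app_of_mem_eval (c : Code) :
    ∀ {n m : ℕ}, m ∈ c.eval n → ∀ᶠ N in atTop, (stage N).App (progCode c) n m := by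
  induction c with
  | zero =>
    intro n m h
    refine eventually_eval (.of_forall fun N => ?_)
    simpa [Code.eval, pure, PFun.pure] using h
  | succ =>
    intro n m h
    refine eventually_eval (.of_forall fun N => ?_)
    simpa [Code.eval] using h
  | left =>
    intro n m h
    obtain rfl : m = n.unpair.1 := by simpa [Code.eval] using h
    refine eventually_eval ?_
    filter_upwards [eventually_isPair n] with N hN
    simpa using hN.1
  | right =>
    intro n m h
    obtain rfl : m = n.unpair.2 := by simpa [Code.eval] using h
    refine eventually_eval ?_
    filter_upwards [eventually_isPair n] with N hN
    simpa using hN.2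
  | pair f g ihf ihg =>
    intro n m h
    obtain ⟨a, hf, b, hg, rfl⟩ := mem_eval_pair.1 h
    refine eventually_eval ?_
    filter_upwards [ihf hf, ihg hg, eventually_pair a b] with N h1 h2 h3
    simpa using ⟨a, b, h1, h2, h3⟩
  | comp f g ihf ihg =>
    intro n m h
    obtain ⟨a, hg, hf⟩ := mem_eval_comp.1 h
    refine eventually_eval ?_
    filter_upwards [ihf hf, ihg hg] with N h1 h2
    simpa using ⟨a, h2, h1⟩
  | prec f g ihf ihg =>
    intro n m h
    obtain ⟨a, k, rfl⟩ : ∃ a k, n = Nat.pair a k := ⟨_, _, (Nat.pair_unpair n).symm⟩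
    induction k generalizing m with
    | zero =>
      rw [Code.eval_prec_zero] at h
      refine eventually_eval ?_
      filter_upwards [ihf h, eventually_pair a 0] with N h1 h2
      simpa using ⟨a, 0, h2, .inl ⟨rfl, h1⟩⟩
    | succ k ih =>
      obtain ⟨i, hi, h⟩ := mem_eval_prec_succ.1 h
      refine eventually_eval ?_
      filter_upwards [ih hi, ihg h, eventually_pair a (k + 1), eventually_pair a k,
        eventually_pair k i, eventually_pair a (Nat.pair k i)] with N h1 h2 h3 h4 h5 h6
      simpa using ⟨a, k + 1, h3, .inr ⟨k, rfl, _, i, h4, h1, _, _, h5, h6, h2⟩⟩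
  | rfind' f ih =>
    intro n m h
    obtain ⟨a, k, rfl⟩ : ∃ a k, n = Nat.pair a k := ⟨_, _, (Nat.pair_unpair n).symm⟩
    -- The result `m` bounds the search, so the distance from `k` to `m` decreases.
    obtain ⟨r, hr⟩ : ∃ r, m < k + r := ⟨m + 1, by omega⟩
    induction r generalizing k with
    | zero => exact absurd (le_of_mem_eval_rfind h) (by omega)
    | succ r ihr =>
      obtain ⟨s, hs, ⟨rfl, rfl⟩ | ⟨hs0, h⟩⟩ := mem_eval_rfind.1 h
      · refine eventually_eval ?_
        filter_upwards [ih hs, eventually_pair a m] with N h1 h2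
        simpa using ⟨a, m, 0, h2, h1, .inl ⟨rfl, rfl⟩⟩
      · refine eventually_eval ?_
        filter_upwards [ih hs, eventually_pair a k, eventually_pair a (k + 1),
          ihr (k + 1) h (by omega)] with N h1 h2 h3 h4
        simpa using ⟨a, k, s, h2, h1, .inr ⟨hs0, k + 1, _, rfl, h3, h4⟩⟩

/-- The rules derive exactly the true statements about the values of programs. -/
theorem exists_stage_iff (c : Code) (n : ℕ) :
    (∃ N m, stage N 2 (Nat.pair (progCode c) n) m) ↔ (c.eval n).Dom := by
  constructor
  · rintro ⟨N, m, h⟩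
    exact Part.dom_iff_mem.2 ⟨m, (sound_stage N).eval _ _ h _ _ rfl⟩
  · intro h
    obtain ⟨m, hm⟩ := Part.dom_iff_mem.1 h
    obtain ⟨N, x, hx, h⟩ := (eventually_app_of_mem_eval c hm).exists
    obtain rfl := (sound_stage N).isPair hx
    exact ⟨N, m, h⟩

end Completeness

/-! ### Syntactic properties of formulas -/

namespace Formula

variable {σ : Signature} {m : ℕ}

/-- A decidable sufficient condition for all free variables of a formula to be in a given list. -/
def freeIn : Formula σ m → List ℕ → Bool
  | atom _ xs, l => decide (∀ j, xs j ∈ l)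
  | neg φ, l => φ.freeIn l
  | and φ ψ, l => φ.freeIn l && ψ.freeIn l
  | all x φ, l => φ.freeIn (x :: l)
  | box _ φ, l => φ.freeIn l

theorem freeVars_subset_of_freeIn {φ : Formula σ m} {l : List ℕ} (h : φ.freeIn l = true) :
    φ.freeVars ⊆ {x | x ∈ l} := by
  induction φ generalizing l with
  | atom p xs =>
    rintro _ ⟨j, rfl⟩
    exact of_decide_eq_true h j
  | neg φ ih => exact ih h
  | and φ ψ ih1 ih2 =>
    simp only [freeIn, Bool.and_eq_true] at h
    exact Set.union_subset (ih1 h.1) (ih2 h.2)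
  | all x φ ih =>
    rintro y ⟨hy, hyx⟩
    exact (List.mem_cons.1 (ih h hy)).resolve_left hyx
  | box a φ ih => exact ih h

instance decidableNonModal : (φ : Formula σ m) → Decidable φ.NonModal
  | atom _ _ => isTrue trivial
  | neg φ => decidableNonModal φ
  | and φ ψ => @instDecidableAnd _ _ (decidableNonModal φ) (decidableNonModal ψ)
  | all _ φ => decidableNonModal φ
  | box _ _ => isFalse id

end Formula

theorem EpistemicModel.sat_congr {σ : Signature} {m : ℕ} {D : Type} {M : EpistemicModel σ m D}
    {φ : Formula σ m} {w : M.World} {v v' : ℕ → D} (h : ∀ x ∈ φ.freeVars, v x = v' x) :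
    M.Sat w v φ ↔ M.Sat w v' φ := by
  induction φ generalizing w v v' with
  | atom p xs =>
    have : (fun j => v (xs j)) = fun j => v' (xs j) := funext fun j => h _ ⟨j, rfl⟩
    simp only [Sat, this]
  | neg φ ih => exact not_congr (ih h)
  | and φ ψ ih1 ih2 =>
    exact and_congr (ih1 fun x hx => h x (.inl hx)) (ih2 fun x hx => h x (.inr hx))
  | all x φ ih =>
    refine forall_congr' fun d => ih fun y hy => ?_
    by_cases hyx : y = x
    · subst hyx
      simp
    · simpa [hyx] using h y ⟨hy, hyx⟩
  | box a φ ih => exact forall₂_congr fun u _ => ih h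

/-! ### First-order formulas about numbered tracks -/

/-- The formulas over one binary and two unary predicate symbols, for a single agent. -/
abbrev GraphFormula := Formula graphSignature 1

namespace GraphFormula

/-- The binary predicate holds of `x` and `y`. -/
def edge (x y : ℕ) : GraphFormula := .atom (0 : Fin 3) (![x, y] : Fin 2 → ℕ)

/-- The first unary predicate holds of `x`. -/
def mark₁ (x : ℕ) : GraphFormula := .atom (1 : Fin 3) (![x] : Fin 1 → ℕ)

/-- The second unary predicate holds of `x`. -/
def mark₂ (x : ℕ) : GraphFormula := .atom (2 : Fin 3) (![x] : Fin 1 → ℕ)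

/-- Disjunction. -/
def or (φ ψ : GraphFormula) : GraphFormula := .neg (.and (.neg φ) (.neg ψ))

/-- The formula `φ` if `b` is true, and its negation otherwise. -/
def signed : Bool → GraphFormula → GraphFormula
  | true, φ => φ
  | false, φ => .neg φ

/-- The element `x` is on track `i`: the two unary predicates spell out `i` in binary. -/
def onTrack (i : Fin 4) (x : ℕ) : GraphFormula :=
  .and (signed (i.val.testBit 0) (mark₁ x)) (signed (i.val.testBit 1) (mark₂ x))

/-- Existential quantification over track `i`. -/
def exTrack (i : Fin 4) (x : ℕ) (φ : GraphFormula) : GraphFormula :=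
  .neg (.all x (.neg (.and (onTrack i x) φ)))

/-- Existential quantification over track `0`, the track that stands for the natural numbers. -/
def ex (x : ℕ) (φ : GraphFormula) : GraphFormula := exTrack 0 x φ

/-- The `i`-th recorded relation holds of the numbers `x` and `y`: there is an edge from `x` to the
copy of `y` on track `i + 1`. The bound variable `x + y + 1` differs from `x` and `y`. -/
def fact (i : Fin 3) (x y : ℕ) : GraphFormula :=
  exTrack i.succ (x + y + 1) (.and (edge (x + y + 1) y) (edge x (x + y + 1)))

/-- The numbers `x` and `y` are equal; equality is not a symbol of the language, but it is
definable from the order. -/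
def eq (x y : ℕ) : GraphFormula := .and (.neg (edge x y)) (.neg (edge y x))

/-- The number `y` is the successor of `x`. -/
def succ (x y : ℕ) : GraphFormula :=
  .and (edge x y) (.neg (ex (x + y + 1) (.and (edge x (x + y + 1)) (edge (x + y + 1) y))))

/-- The number `x` is the numeral `k`. -/
def num : ℕ → ℕ → GraphFormula
  | 0, x => .neg (ex (x + 1) (edge (x + 1) x))
  | k + 1, x => ex (x + 1) (.and (succ (x + 1) x) (num k (x + 1)))

end GraphFormula

open GraphFormula

/-- The world `w` of `M` represents the facts `F` when the domain is partitioned into four copies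
`mk i` of the natural numbers, the tracks. The unary predicates tell the tracks apart. Within track
`0` the edges are the order of the natural numbers, from another track to track `0` they link the
copies of the same number, and from track `0` to track `i + 1` they record the facts `F i`. -/
structure Represents {D : Type} (M : EpistemicModel graphSignature 1 D) (w : M.World)
    (mk : Fin 4 → ℕ → D) (F : Facts) : Prop where
  surj : ∀ d, ∃ i n, d = mk i n
  mark₁_iff : ∀ i n, M.interp w (1 : Fin 3) (![mk i n] : Fin 1 → D) ↔ i.val.testBit 0
  mark₂_iff : ∀ i n, M.interp w (2 : Fin 3) (![mk i n] : Fin 1 → D) ↔ i.val.testBit 1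
  order_iff : ∀ a b, M.interp w (0 : Fin 3) (![mk 0 a, mk 0 b] : Fin 2 → D) ↔ a < b
  copy_iff : ∀ (i : Fin 3) a b,
    M.interp w (0 : Fin 3) (![mk i.succ a, mk 0 b] : Fin 2 → D) ↔ a = b
  fact_iff : ∀ (i : Fin 3) a b,
    M.interp w (0 : Fin 3) (![mk 0 a, mk i.succ b] : Fin 2 → D) ↔ F i a b

section Sat

variable {D : Type} {M : EpistemicModel graphSignature 1 D} {w : M.World} {v : ℕ → D}

open EpistemicModel (Sat)

@[simp]
theorem sat_neg {φ : GraphFormula} : M.Sat w v (.neg φ) ↔ ¬ M.Sat w v φ := Iff.rfl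

@[simp]
theorem sat_and {φ ψ : GraphFormula} : M.Sat w v (.and φ ψ) ↔ M.Sat w v φ ∧ M.Sat w v ψ := Iff.rfl

@[simp]
theorem sat_or {φ ψ : GraphFormula} : M.Sat w v (or φ ψ) ↔ M.Sat w v φ ∨ M.Sat w v ψ := by
  simp only [GraphFormula.or, sat_neg, sat_and]
  tauto

theorem sat_edge {x y : ℕ} :
    M.Sat w v (edge x y) ↔ M.interp w (0 : Fin 3) (![v x, v y] : Fin 2 → D) := by
  have : (fun j => v ((![x, y] : Fin 2 → ℕ) j)) = ![v x, v y] := by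
    funext j
    fin_cases j <;> rfl
  rw [← this]
  rfl

theorem sat_mark₁ {x : ℕ} :
    M.Sat w v (mark₁ x) ↔ M.interp w (1 : Fin 3) (![v x] : Fin 1 → D) := by
  have : (fun j => v ((![x] : Fin 1 → ℕ) j)) = ![v x] := by
    funext j
    fin_cases j; rfl
  rw [← this]
  rfl

theorem sat_mark₂ {x : ℕ} :
    M.Sat w v (mark₂ x) ↔ M.interp w (2 : Fin 3) (![v x] : Fin 1 → D) := by
  have : (fun j => v ((![x] : Fin 1 → ℕ) j)) = ![v x] := by
    funext j
    fin_cases j; rfl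
  rw [← this]
  rfl

@[simp]
theorem sat_signed {b : Bool} {φ : GraphFormula} :
    M.Sat w v (signed b φ) ↔ (M.Sat w v φ ↔ b = true) := by
  cases b <;> simp [signed]

namespace Represents

variable {mk : Fin 4 → ℕ → D} {F : Facts} {ν : ℕ → ℕ}

theorem sat_onTrack (hF : Represents M w mk F) {i j : Fin 4} {x n : ℕ} (hx : v x = mk j n) :
    M.Sat w v (onTrack i x) ↔ i = j := by
  simp only [onTrack, sat_and, sat_signed, sat_mark₁, sat_mark₂, hx, hF.mark₁_iff, hF.mark₂_iff]
  fin_cases i <;> fin_cases j <;> decide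

theorem sat_exTrack (hF : Represents M w mk F) {i : Fin 4} {x : ℕ} {φ : GraphFormula} :
    M.Sat w v (exTrack i x φ) ↔ ∃ n, M.Sat w (Function.update v x (mk i n)) φ := by
  have : M.Sat w v (exTrack i x φ) ↔
      ∃ d, M.Sat w (Function.update v x d) (onTrack i x) ∧ M.Sat w (Function.update v x d) φ := by
    simp [exTrack, Sat]
  rw [this]
  constructor
  · rintro ⟨d, hd, h⟩
    obtain ⟨j, n, rfl⟩ := hF.surj d
    obtain rfl := (hF.sat_onTrack (Function.update_self ..)).1 hd
    exact ⟨n, h⟩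
  · rintro ⟨n, h⟩
    exact ⟨_, (hF.sat_onTrack (Function.update_self ..)).2 rfl, h⟩

theorem sat_ex (hF : Represents M w mk F) {x : ℕ} {φ : GraphFormula} :
    M.Sat w (mk 0 ∘ ν) (ex x φ) ↔ ∃ n, M.Sat w (mk 0 ∘ Function.update ν x n) φ := by
  simp only [ex, hF.sat_exTrack, Function.comp_update]

theorem sat_lt (hF : Represents M w mk F) {x y : ℕ} :
    M.Sat w (mk 0 ∘ ν) (edge x y) ↔ ν x < ν y := by
  simp [sat_edge, hF.order_iff]

theorem sat_fact (hF : Represents M w mk F) {i : Fin 3} {x y : ℕ} :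
    M.Sat w (mk 0 ∘ ν) (fact i x y) ↔ F i (ν x) (ν y) := by
  have hx : x ≠ x + y + 1 := by omega
  have hy : y ≠ x + y + 1 := by omega
  simp [GraphFormula.fact, hF.sat_exTrack, sat_edge, hx, hy, hF.copy_iff, hF.fact_iff]

theorem sat_eq (hF : Represents M w mk F) {x y : ℕ} :
    M.Sat w (mk 0 ∘ ν) (eq x y) ↔ ν x = ν y := by
  simp only [GraphFormula.eq, sat_and, sat_neg, hF.sat_lt]
  omega

theorem sat_succ (hF : Represents M w mk F) {x y : ℕ} :
    M.Sat w (mk 0 ∘ ν) (succ x y) ↔ ν y = ν x + 1 := by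
  have hx : x ≠ x + y + 1 := by omega
  have hy : y ≠ x + y + 1 := by omega
  simp only [GraphFormula.succ, sat_and, sat_neg, hF.sat_lt, hF.sat_ex, Function.update_self,
    Function.update_of_ne hx, Function.update_of_ne hy, not_exists]
  constructor
  · rintro ⟨h1, h2⟩
    have := h2 (ν x + 1)
    omega
  · intro h
    exact ⟨by omega, fun z => by omega⟩

theorem sat_num (hF : Represents M w mk F) {k x : ℕ} :
    M.Sat w (mk 0 ∘ ν) (num k x) ↔ ν x = k := by
  induction k generalizing x ν with
  | zero =>
    simp only [num, sat_neg, hF.sat_ex, hF.sat_lt, Function.update_self,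
      Function.update_of_ne (Nat.succ_ne_self x).symm, not_exists, not_lt]
    exact ⟨fun h => Nat.le_zero.1 (h 0), fun h z => h ▸ Nat.zero_le z⟩
  | succ k ih =>
    simp [num, hF.sat_ex, hF.sat_succ, ih]

end Represents

end Sat

/-! ### The rules as first-order formulas -/

namespace GraphFormula

/-- The facts record that `x` is the pair of `a` and `b`. -/
def isPair (x a b : ℕ) : GraphFormula := .and (fact 0 x a) (fact 1 x b)

/-- The facts record that the program `c` on input `n` yields `m`. -/
def app (c n m : ℕ) : GraphFormula :=
  ex (c + n + m + 1) (.and (isPair (c + n + m + 1) c n) (fact 2 (c + n + m + 1) m))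

/-- The facts record that the predecessor of `x` is the pair of `a` and `b`. -/
def predIsPair (x a b : ℕ) : GraphFormula :=
  ex (x + a + b + 1) (.and (succ (x + a + b + 1) x) (isPair (x + a + b + 1) a b))

/-- The rule for first components, about the variables `0` and `2`; the variable `1` is reserved for
the target of the new edge, which is not on track `0`. -/
def fstRule : GraphFormula :=
  or (.and (num 0 0) (num 0 2)) <| ex 3 <| ex 4 <| .and (predIsPair 0 3 4) <|
    or (.and (edge 3 4) (succ 3 2)) <| or (.and (edge 4 3) (eq 2 3)) (.and (eq 3 4) (num 0 2))

/-- The rule for second components, about the variables `0` and `2`. -/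
def sndRule : GraphFormula :=
  or (.and (num 0 0) (num 0 2)) <| ex 3 <| ex 4 <| .and (predIsPair 0 3 4) <|
    or (.and (edge 3 4) (or (.and (succ 3 4) (num 0 2)) (.and (.neg (succ 3 4)) (eq 2 4))))
      (.and (.neg (edge 3 4)) (succ 4 2))

/-- The rule for pairing. As in the other clauses, the variables bound here are `9` and larger, so
that they differ from the arguments when those are below `9`. -/
def pairClause (f g n m : ℕ) : GraphFormula :=
  ex 9 <| ex 10 <| .and (app f n 9) <| .and (app g n 10) (isPair m 9 10)

/-- The rule for composition. -/
def compClause (f g n m : ℕ) : GraphFormula :=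
  ex 9 <| .and (app g n 9) (app f 9 m)

/-- The rule for primitive recursion. -/
def precClause (c f g n m : ℕ) : GraphFormula :=
  ex 9 <| ex 10 <| .and (isPair n 9 10) <| or (.and (num 0 10) (app f 9 m)) <|
    ex 11 <| .and (succ 11 10) <| ex 12 <| ex 13 <| .and (isPair 12 9 11) <| .and (app c 12 13) <|
      ex 14 <| ex 15 <| .and (isPair 14 11 13) <| .and (isPair 15 9 14) (app g 15 m)

/-- The rule for unbounded search. -/
def rfindClause (c f n m : ℕ) : GraphFormula :=
  ex 9 <| ex 10 <| ex 11 <| .and (isPair n 9 10) <| .and (app f n 11) <|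
    or (.and (num 0 11) (eq m 10)) <| .and (.neg (num 0 11)) <|
      ex 12 <| ex 13 <| .and (succ 10 12) <| .and (isPair 13 9 12) (app c 13 m)

/-- The evaluation rules, about the variables `0` and `2`. -/
def evalRule : GraphFormula :=
  ex 3 <| ex 4 <| ex 5 <| ex 6 <| ex 7 <| ex 8 <|
    .and (isPair 0 3 4) <| .and (isPair 3 5 6) <| .and (isPair 6 7 8) <|
    or (.and (num 0 5) (num 0 2)) <| or (.and (num 1 5) (succ 4 2)) <|
    or (.and (num 2 5) (fact 0 4 2)) <| or (.and (num 3 5) (fact 1 4 2)) <|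
    or (.and (num 4 5) (pairClause 7 8 4 2)) <| or (.and (num 5 5) (compClause 7 8 4 2)) <|
    or (.and (num 6 5) (precClause 3 7 8 4 2)) (.and (num 7 5) (rfindClause 3 7 4 2))

/-- The three rules, in the order of the relations that they extend. -/
def rule : Fin 3 → GraphFormula := ![fstRule, sndRule, evalRule]

theorem freeIn_rule (i : Fin 3) : (rule i).freeIn [0, 2] = true := by
  fin_cases i <;> decide +kernel

end GraphFormula

namespace Represents

variable {D : Type} {M : EpistemicModel graphSignature 1 D} {w : M.World} {mk : Fin 4 → ℕ → D}
  {F : Facts} {ν : ℕ → ℕ}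

theorem sat_isPair (hF : Represents M w mk F) {x a b : ℕ} :
    M.Sat w (mk 0 ∘ ν) (isPair x a b) ↔ F.IsPair (ν x) (ν a) (ν b) := by
  simp only [isPair, sat_and, hF.sat_fact, Facts.IsPair]

theorem sat_app (hF : Represents M w mk F) {c n m : ℕ} :
    M.Sat w (mk 0 ∘ ν) (app c n m) ↔ F.App (ν c) (ν n) (ν m) := by
  have hc : c ≠ c + n + m + 1 := by omega
  have hn : n ≠ c + n + m + 1 := by omega
  have hm : m ≠ c + n + m + 1 := by omega
  simp only [app, hF.sat_ex, sat_and, hF.sat_isPair, hF.sat_fact, Facts.App, Function.update_self,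
    Function.update_of_ne hc, Function.update_of_ne hn, Function.update_of_ne hm]

theorem sat_predIsPair (hF : Represents M w mk F) {x a b : ℕ} :
    M.Sat w (mk 0 ∘ ν) (predIsPair x a b) ↔ F.PredIsPair (ν x) (ν a) (ν b) := by
  have hx : x ≠ x + a + b + 1 := by omega
  have ha : a ≠ x + a + b + 1 := by omega
  have hb : b ≠ x + a + b + 1 := by omega
  simp only [predIsPair, hF.sat_ex, sat_and, hF.sat_isPair, hF.sat_succ, Facts.PredIsPair,
    Function.update_self, Function.update_of_ne hx, Function.update_of_ne ha,
    Function.update_of_ne hb]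

theorem sat_rule (hF : Represents M w mk F) (i : Fin 3) :
    M.Sat w (mk 0 ∘ ν) (rule i) ↔ F.step i (ν 0) (ν 2) := by
  fin_cases i
  · simp [rule, fstRule, Facts.step, Facts.fstRule, hF.sat_ex, hF.sat_num, hF.sat_predIsPair,
      hF.sat_lt, hF.sat_succ, hF.sat_eq]
  · simp [rule, sndRule, Facts.step, Facts.sndRule, hF.sat_ex, hF.sat_num, hF.sat_predIsPair,
      hF.sat_lt, hF.sat_succ, hF.sat_eq]
  · simp [rule, evalRule, Facts.step, Facts.evalRule, hF.sat_ex, hF.sat_num, hF.sat_isPair,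
      hF.sat_app, hF.sat_succ, hF.sat_eq, hF.sat_fact, pairClause, compClause,
      precClause, rfindClause, Facts.pairClause, Facts.compClause, Facts.precClause,
      Facts.rfindClause]

/-- The meaning of a rule depends only on the two variables that it is about. -/
theorem sat_rule' (hF : Represents M w mk F) (i : Fin 3) {v : ℕ → D} {x y : ℕ}
    (hx : v 0 = mk 0 x) (hy : v 2 = mk 0 y) :
    M.Sat w v (rule i) ↔ F.step i x y := by
  have h := hF.sat_rule (ν := fun k => if k = 0 then x else y) i
  rw [if_pos rfl, if_neg two_ne_zero] at h
  rw [← h]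
  refine EpistemicModel.sat_congr fun k hk => ?_
  have hk := Formula.freeVars_subset_of_freeIn (freeIn_rule i) hk
  rcases (by simpa using hk : k = 0 ∨ k = 2) with rfl | rfl <;> simp [hx, hy]

end Represents

/-! ### The action model -/

/-- The postcondition for the binary predicate. Edges into track `0` are kept. A number `a` gets an
edge to the copy of `b` on track `i + 1` if the `i`-th rule applies to `a` and `b`; here `a`, the copy
of `b`, and `b` itself are the values of the variables `0`, `1` and `2`. -/
def edgePost : GraphFormula :=
  or (.and (onTrack 0 1) (edge 0 1)) <| .and (onTrack 0 0) <| ex 2 <| .and (edge 1 2) <|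
    or (.and (onTrack 1 1) (rule 0)) <| or (.and (onTrack 2 1) (rule 1))
      (.and (onTrack 3 1) (rule 2))

/-- The single event applies all rules once and leaves the unary predicates unchanged. Its
precondition is a tautology. -/
def ruleAction : ActionModel graphSignature 1 where
  numEvents := 1
  numEvents_pos := one_pos
  rel _ _ _ := true
  pre _ := .all 0 (.neg (.and (mark₁ 0) (.neg (mark₁ 0))))
  post _ := ![edgePost, mark₁ 0, mark₂ 0]
  pre_closed _ := by
    have h : (Formula.freeIn (.all 0 (.neg (.and (mark₁ 0) (.neg (mark₁ 0))))) []) = true := rfl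
    simpa using Formula.freeVars_subset_of_freeIn h
  post_freeVars _ p := by
    have h : ((![edgePost, mark₁ 0, mark₂ 0] : Fin 3 → GraphFormula) p).freeIn
        (List.range (graphSignature.arity p)) = true := by
      revert p
      decide +kernel
    simpa using Formula.freeVars_subset_of_freeIn h

theorem ruleAction_nonModal : ruleAction.NonModal := by
  have h : ∀ p : Fin 3, ((![edgePost, mark₁ 0, mark₂ 0] : Fin 3 → GraphFormula) p).NonModal := by
    decide +kernel
  exact ⟨fun _ => ⟨trivial, trivial⟩, fun _ => h⟩

namespace Represents

variable {D : Type} {M : EpistemicModel graphSignature 1 D} {mk : Fin 4 → ℕ → D} {F : Facts}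

theorem holds_pre (w : M.World) (e : Fin ruleAction.numEvents) :
    M.Holds w (ruleAction.pre e) := by
  intro v d h
  exact h.2 h.1

theorem sat_edgePost {w : M.World} (hF : Represents M w mk F) {v : ℕ → D} {i j : Fin 4} {a b : ℕ}
    (h0 : v 0 = mk i a) (h1 : v 1 = mk j b) : M.Sat w v edgePost ↔
      (j = 0 ∧ M.interp w (0 : Fin 3) (![mk i a, mk j b] : Fin 2 → D)) ∨
      (i = 0 ∧ ∃ k : Fin 3, j = k.succ ∧ F.step k a b) := by
  -- If the source is a number then so are both variables of the rule.
  have key : ∀ n k, i = 0 → (M.Sat w (Function.update v 2 (mk 0 n)) (rule k) ↔ F.step k a n) := by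
    rintro n k rfl
    exact hF.sat_rule' k (by simp [h0]) (by simp)
  have track : ∀ n k, M.Sat w (Function.update v 2 (mk 0 n)) (onTrack k 1) ↔ k = j := fun n k =>
    hF.sat_onTrack (by simpa using h1)
  simp only [edgePost, sat_or, sat_and, ex, hF.sat_exTrack, track, hF.sat_onTrack h0,
    hF.sat_onTrack h1, sat_edge, h0, h1]
  refine or_congr (and_congr eq_comm Iff.rfl) ?_
  rw [eq_comm (a := 0)]
  refine and_congr_right fun hi => ?_
  simp only [key _ _ hi]
  have h2 : ∀ n, (![Function.update v 2 (mk 0 n) 1, Function.update v 2 (mk 0 n) 2] : Fin 2 → D) =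
      ![mk j b, mk 0 n] := fun n => by simp [h1]
  simp only [h2]
  -- The only number that a copy of `b` is linked to is `b`.
  have h3 : j ≠ 0 → ∀ n, (M.interp w (0 : Fin 3) (![mk j b, mk 0 n] : Fin 2 → D) ↔ b = n) := by
    intro hj n
    obtain ⟨k, rfl⟩ := Fin.exists_succ_eq.2 hj
    exact hF.copy_iff k b n
  constructor
  · rintro ⟨n, hn, ⟨rfl, h⟩ | ⟨rfl, h⟩ | ⟨rfl, h⟩⟩
    all_goals obtain rfl := (h3 (by decide) n).1 hn
    exacts [⟨0, rfl, h⟩, ⟨1, rfl, h⟩, ⟨2, rfl, h⟩]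
  · rintro ⟨k, rfl, h⟩
    refine ⟨b, (h3 (Fin.succ_ne_zero k) b).2 rfl, ?_⟩
    fin_cases k
    exacts [.inl ⟨rfl, h⟩, .inr (.inl ⟨rfl, h⟩), .inr (.inr ⟨rfl, h⟩)]

/-- Updating with the rule event replaces the recorded facts by their immediate consequences. -/
theorem update {x : (M.update ruleAction).World} (hF : Represents M x.1.1 mk F) :
    Represents (M.update ruleAction) x mk F.step := by
  have hedge : ∀ i a j b,
      (M.update ruleAction).interp x (0 : Fin 3) (![mk i a, mk j b] : Fin 2 → D) ↔
        (j = 0 ∧ M.interp x.1.1 (0 : Fin 3) (![mk i a, mk j b] : Fin 2 → D)) ∨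
          (i = 0 ∧ ∃ k : Fin 3, j = k.succ ∧ F.step k a b) := by
    intro i a j b
    constructor
    · intro h
      exact (hF.sat_edgePost (v := fun k => if k = 0 then mk i a else mk j b) rfl rfl).1
        (h _ (Fin.forall_fin_two.2 ⟨rfl, rfl⟩))
    · intro h v hv
      exact (hF.sat_edgePost (hv (0 : Fin 2)) (hv (1 : Fin 2))).2 h
  constructor
  · exact hF.surj
  · intro i n
    rw [← hF.mark₁_iff i n]
    constructor
    · intro h
      exact (sat_mark₁ (x := 0)).1 (h (fun _ => mk i n) (Fin.forall_fin_one.2 rfl))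
    · intro h v hv
      have hv : v 0 = mk i n := hv (0 : Fin 1)
      exact sat_mark₁.2 (by rwa [hv])
  · intro i n
    rw [← hF.mark₂_iff i n]
    constructor
    · intro h
      exact (sat_mark₂ (x := 0)).1 (h (fun _ => mk i n) (Fin.forall_fin_one.2 rfl))
    · intro h v hv
      have hv : v 0 = mk i n := hv (0 : Fin 1)
      exact sat_mark₂.2 (by rwa [hv])
  · intro a b
    rw [hedge, hF.order_iff]
    simp [(Fin.succ_ne_zero _).symm]
  · intro i a b
    rw [hedge, hF.copy_iff]
    simp
  · intro i a b
    rw [hedge]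
    simp

/-- Every world of the `N`-th update records the facts derived in `N` rounds, if no facts are
recorded at first. -/
theorem iter (hM : ∀ w, Represents M w mk (Facts.stage 0)) (N : ℕ)
    (h : (M.iter ruleAction N).World) : Represents (M.iter ruleAction N) h mk (Facts.stage N) := by
  induction N with
  | zero => exact hM h
  | succ N ih => exact (ih h.1.1).update

/-- A history of any length can be continued with the rule event. -/
theorem nonempty_iter (w : M.World) (N : ℕ) : Nonempty (M.iter ruleAction N).World := by
  induction N with
  | zero => exact ⟨w⟩
  | succ N ih => exact ih.map fun h => ⟨(h, ⟨0, one_pos⟩), holds_pre h _⟩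

/-- The model of histories interprets the predicates at a history as the iterated update does. -/
theorem histories {N : ℕ} {h : (M.iter ruleAction N).World}
    (hF : Represents (M.iter ruleAction N) h mk F) :
    Represents (M.histories ruleAction) ⟨N, h⟩ mk F :=
  ⟨hF.surj, hF.mark₁_iff, hF.mark₂_iff, hF.order_iff, hF.copy_iff, hF.fact_iff⟩

end Represents

/-! ### The goal formula -/

namespace GraphFormula

/-- The number `k` more than the variable `0` has a value. Only the variables `0` and `1` are used,
in turns, so that the codes of these formulas satisfy a simple recursion. -/
def valueAfter : ℕ → GraphFormula
  | 0 => ex 1 (fact 2 0 1)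
  | k + 1 => ex 1 (.and (succ 0 1) (ex 0 (.and (eq 0 1) (valueAfter k))))

/-- The number `k` has a value. -/
def hasValue (k : ℕ) : GraphFormula := ex 0 (.and (num 0 0) (valueAfter k))

theorem freeIn_edge (x y : ℕ) (l : List ℕ) : (edge x y).freeIn l = decide (x ∈ l ∧ y ∈ l) :=
  decide_eq_decide.2 Fin.forall_fin_two

theorem freeIn_onTrack (i : Fin 4) (x : ℕ) (l : List ℕ) :
    (onTrack i x).freeIn l = decide (x ∈ l) := by
  have h₁ : (mark₁ x).freeIn l = decide (x ∈ l) := decide_eq_decide.2 Fin.forall_fin_one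
  have h₂ : (mark₂ x).freeIn l = decide (x ∈ l) := decide_eq_decide.2 Fin.forall_fin_one
  have hs : ∀ b φ, (signed b φ).freeIn l = φ.freeIn l := by rintro (_ | _) φ <;> rfl
  simp [onTrack, Formula.freeIn, hs, h₁, h₂]

theorem freeIn_exTrack (i : Fin 4) (x : ℕ) (φ : GraphFormula) (l : List ℕ) :
    (exTrack i x φ).freeIn l = φ.freeIn (x :: l) := by
  simp [exTrack, Formula.freeIn, freeIn_onTrack]

theorem freeIn_valueAfter (k : ℕ) {l : List ℕ} (h : 0 ∈ l) : (valueAfter k).freeIn l = true := by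
  induction k generalizing l with
  | zero =>
    simp [valueAfter, ex, freeIn_exTrack, GraphFormula.fact, freeIn_edge, Formula.freeIn, h]
  | succ k ih =>
    simp [valueAfter, ex, freeIn_exTrack, GraphFormula.succ, GraphFormula.eq, freeIn_edge,
      Formula.freeIn, h, ih]

theorem freeVars_hasValue (k : ℕ) : (hasValue k).freeVars = ∅ := by
  have h : (hasValue k).freeIn [] = true := by
    simp [hasValue, num, ex, freeIn_exTrack, freeIn_edge, Formula.freeIn, freeIn_valueAfter]
  simpa using Formula.freeVars_subset_of_freeIn h

end GraphFormula

namespace Represents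

variable {D : Type} {M : EpistemicModel graphSignature 1 D} {w : M.World} {mk : Fin 4 → ℕ → D}
  {F : Facts} {ν : ℕ → ℕ}

theorem sat_valueAfter (hF : Represents M w mk F) {k : ℕ} :
    M.Sat w (mk 0 ∘ ν) (valueAfter k) ↔ ∃ m, F 2 (ν 0 + k) m := by
  induction k generalizing ν with
  | zero => simp [valueAfter, hF.sat_ex, hF.sat_fact]
  | succ k ih =>
    simp [valueAfter, hF.sat_ex, hF.sat_succ, hF.sat_eq, ih, add_assoc, add_comm 1 k]

theorem holds_hasValue (hF : Represents M w mk F) {k : ℕ} :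
    M.Holds w (hasValue k) ↔ ∃ m, F 2 k m := by
  -- The goal is closed, so it may be evaluated under an assignment of numbers to all variables.
  have h : ∀ v v', M.Sat w v (hasValue k) ↔ M.Sat w v' (hasValue k) := fun v v' =>
    EpistemicModel.sat_congr (by simp [freeVars_hasValue])
  have h0 : M.Sat w (mk 0 ∘ fun _ => 0) (hasValue k) ↔ ∃ m, F 2 k m := by
    simp [hasValue, hF.sat_ex, hF.sat_num, hF.sat_valueAfter]
  rw [← h0]
  exact ⟨fun hv => hv _, fun hv v => (h _ _).1 hv⟩

end Represents

/-! ### Runs of automata and convolutions -/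

/-- The automaton accepts a word when it starts from the state `q`. -/
def Automaton.Accepts {α : Type} (A : Automaton α) (q : Fin A.numStates) : List α → Prop
  | [] => q ∈ A.accept
  | c :: w => ∃ q', (q, c, q') ∈ A.trans ∧ A.Accepts q' w

theorem Automaton.mem_language_iff {α : Type} {A : Automaton α} {w : List α} :
    w ∈ A.language ↔ ∃ q ∈ A.start, A.Accepts q w := by
  have h : ∀ (w : List α) (S : Set (Fin A.numStates)),
      w ∈ A.toNFA.acceptsFrom S ↔ ∃ q ∈ S, A.Accepts q w := by
    intro w
    induction w with
    | nil => exact fun S => NFA.nil_mem_acceptsFrom _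
    | cons c w ih =>
      intro S
      rw [NFA.cons_mem_acceptsFrom, ih]
      simp only [NFA.mem_stepSet, Accepts]
      constructor
      · rintro ⟨q', ⟨q, hq, hqq'⟩, h⟩
        exact ⟨q, hq, q', hqq', h⟩
      · rintro ⟨q, hq, q', hqq', h⟩
        exact ⟨q', ⟨q, hq, hqq'⟩, h⟩
  exact h w _

theorem Automaton.accepts_nil_iff {α : Type} {A : Automaton α} {q : Fin A.numStates} :
    A.Accepts q [] ↔ q ∈ A.accept := Iff.rfl

theorem Automaton.accepts_cons_iff {α : Type} {A : Automaton α} {q r : Fin A.numStates} {c : α}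
    {w : List α} (h : ∀ q', (q, c, q') ∈ A.trans ↔ q' = r) :
    A.Accepts q (c :: w) ↔ A.Accepts r w := by
  simp [Accepts, h]

theorem Automaton.not_accepts_cons {α : Type} {A : Automaton α} {q : Fin A.numStates} {c : α}
    {w : List α} (h : ∀ q', (q, c, q') ∉ A.trans) : ¬ A.Accepts q (c :: w) := by
  simp [Accepts, h]

section Convolution

variable {k : ℕ} {α : Type}

theorem convolution_nil : convolution (fun _ : Fin k => ([] : List α)) = [] := by
  simp [convolution]

theorem convolution_cons {u : Fin k → List α} (h : ∃ j, u j ≠ []) :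
    convolution u = (fun j => (u j).head?) :: convolution fun j => (u j).tail := by
  have hsup : (Finset.univ.sup fun j => (u j).length) =
      (Finset.univ.sup fun j => (u j).tail.length) + 1 := by
    apply le_antisymm
    · refine Finset.sup_le fun j _ => ?_
      have := Finset.le_sup (f := fun j => (u j).tail.length) (Finset.mem_univ j)
      simp only [List.length_tail] at this ⊢
      omega
    · obtain ⟨j, hj⟩ := h
      have hj := List.length_pos_iff.2 hj
      have h1 : (Finset.univ.sup fun j => (u j).tail.length) ≤
          (Finset.univ.sup fun j => (u j).length) - 1 := by
        refine Finset.sup_le fun i _ => ?_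
        have := Finset.le_sup (f := fun j => (u j).length) (Finset.mem_univ i)
        simp only [List.length_tail] at this ⊢
        omega
      have h2 := Finset.le_sup (f := fun j => (u j).length) (Finset.mem_univ j)
      omega
  simp only [convolution, hsup, List.range_succ_eq_map, List.map_cons, List.map_map,
    List.head?_eq_getElem?, List.getElem?_tail]
  rfl

theorem convolution_single (u : List α) : convolution ![u] = u.map fun a => ![some a] := by
  induction u with
  | nil =>
    rw [show (![[]] : Fin 1 → List α) = fun _ => [] from funext (Fin.forall_fin_one.2 rfl)]
    exact convolution_nil
  | cons a u ih =>
    rw [convolution_cons ⟨0, by simp⟩, List.map_cons, ← ih]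
    congr 1
    · exact funext (Fin.forall_fin_one.2 rfl)
    · exact congrArg convolution (funext (Fin.forall_fin_one.2 rfl))

theorem convolution_nil_nil : convolution ![([] : List α), []] = [] := by
  rw [show (![[], []] : Fin 2 → List α) = fun _ => [] from funext (Fin.forall_fin_two.2 ⟨rfl, rfl⟩)]
  exact convolution_nil

theorem convolution_cons_cons (a b : α) (u v : List α) :
    convolution ![a :: u, b :: v] = ![some a, some b] :: convolution ![u, v] := by
  rw [convolution_cons ⟨0, List.cons_ne_nil a u⟩]
  congr 1
  · exact funext (Fin.forall_fin_two.2 ⟨rfl, rfl⟩)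
  · exact congrArg convolution (funext (Fin.forall_fin_two.2 ⟨rfl, rfl⟩))

theorem convolution_nil_cons (b : α) (v : List α) :
    convolution ![[], b :: v] = ![none, some b] :: convolution ![[], v] := by
  rw [convolution_cons ⟨1, List.cons_ne_nil b v⟩]
  congr 1
  · exact funext (Fin.forall_fin_two.2 ⟨rfl, rfl⟩)
  · exact congrArg convolution (funext (Fin.forall_fin_two.2 ⟨rfl, rfl⟩))

theorem convolution_cons_nil (a : α) (u : List α) :
    convolution ![a :: u, []] = ![some a, none] :: convolution ![u, []] := by
  rw [convolution_cons ⟨0, List.cons_ne_nil a u⟩]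
  congr 1
  · exact funext (Fin.forall_fin_two.2 ⟨rfl, rfl⟩)
  · exact congrArg convolution (funext (Fin.forall_fin_two.2 ⟨rfl, rfl⟩))

end Convolution

/-! ### The automatic model -/

/-- The word that stands for the copy of the number `n` on track `i`. -/
def trackWord (i : Fin 4) (n : ℕ) : List (Fin 4) := i :: List.replicate n 0

/-- Recognizes the words `trackWord i n`. -/
abbrev domainAut : Automaton (Fin 4) where
  numStates := 2
  start := [0]
  accept := [1]
  trans := (1, 0, 1) :: (List.finRange 4).map fun i => (0, i, 1)

/-- Recognizes the words `trackWord i n` for which the `j`-th binary digit of `i` is `1`. -/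
abbrev markAut (j : ℕ) : Automaton (Fin 1 → Option (Fin 4)) where
  numStates := 2
  start := [0]
  accept := [1]
  trans := (1, ![some 0], 1) ::
    ((List.finRange 4).filter fun i => i.val.testBit j).map fun i => (0, ![some i], 1)

/-- Recognizes the pairs of `trackWord 0 a` and `trackWord 0 b` with `a < b`, through the states `1`
and `2`, and the pairs of `trackWord i a` and `trackWord 0 a` with `i ≠ 0`, through the state `3`. -/
abbrev edgeAut : Automaton (Fin 2 → Option (Fin 4)) where
  numStates := 4
  start := [0]
  accept := [2, 3]
  trans := [(0, ![some 0, some 0], 1), (1, ![some 0, some 0], 1), (1, ![none, some 0], 2),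
    (2, ![none, some 0], 2), (0, ![some 1, some 0], 3), (0, ![some 2, some 0], 3),
    (0, ![some 3, some 0], 3), (3, ![some 0, some 0], 3)]

theorem mem_domainAut_iff {u : List (Fin 4)} :
    u ∈ domainAut.language ↔ ∃ i n, u = trackWord i n := by
  have h1 : ∀ u, domainAut.Accepts 1 u ↔ ∃ n, u = List.replicate n 0 := by
    intro u
    induction u with
    | nil => exact iff_of_true (List.mem_singleton.2 rfl) ⟨0, rfl⟩
    | cons c u ih =>
      by_cases hc : c = 0
      · subst hc
        rw [Automaton.accepts_cons_iff (r := 1) (by decide), ih]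
        constructor
        · rintro ⟨n, rfl⟩
          exact ⟨n + 1, rfl⟩
        · rintro ⟨_ | n, hn⟩
          · cases hn
          · exact ⟨n, (List.cons.inj hn).2⟩
      · refine iff_of_false (Automaton.not_accepts_cons ?_) ?_
        · revert c
          decide
        · rintro ⟨_ | n, hn⟩
          · cases hn
          · exact hc (List.cons.inj hn).1
  have h0 : ∀ i u, domainAut.Accepts 0 (i :: u) ↔ domainAut.Accepts 1 u := fun i u =>
    Automaton.accepts_cons_iff (by revert i; decide)
  rw [Automaton.mem_language_iff]
  constructor
  · rintro ⟨q, hq, h⟩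
    obtain rfl := List.mem_singleton.1 hq
    rcases u with _ | ⟨i, u⟩
    · exact absurd (Automaton.accepts_nil_iff.1 h) (by decide)
    · rw [h0, h1] at h
      obtain ⟨n, rfl⟩ := h
      exact ⟨i, n, rfl⟩
  · rintro ⟨i, n, rfl⟩
    exact ⟨0, List.mem_singleton.2 rfl, (h0 _ _).2 ((h1 _).2 ⟨n, rfl⟩)⟩

theorem mem_markAut_iff {j : ℕ} {i : Fin 4} {n : ℕ} :
    convolution ![trackWord i n] ∈ (markAut j).language ↔ i.val.testBit j := by
  have h1 : (markAut j).Accepts 1 (convolution ![List.replicate n 0]) := by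
    rw [convolution_single]
    induction n with
    | zero => exact List.mem_singleton.2 rfl
    | succ n ih => exact ⟨1, List.mem_cons_self, ih⟩
  have hinj : ∀ a b : Fin 4, (![some a] : Fin 1 → Option (Fin 4)) = ![some b] → a = b := by decide
  rw [convolution_single] at h1
  rw [Automaton.mem_language_iff, convolution_single, trackWord, List.map_cons]
  constructor
  · rintro ⟨q, hq, q', hqq', -⟩
    obtain rfl := List.mem_singleton.1 hq
    rcases List.mem_cons.1 hqq' with h | h
    · exact absurd (congrArg Prod.fst h) (zero_ne_one (α := Fin 2))
    · obtain ⟨i', hi', h⟩ := List.mem_map.1 h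
      obtain rfl := hinj _ _ (congrArg (fun t => t.2.1) h)
      exact (List.mem_filter.1 hi').2
  · intro h
    exact ⟨0, List.mem_singleton.2 rfl, 1, List.mem_cons_of_mem _
      (List.mem_map.2 ⟨i, List.mem_filter.2 ⟨List.mem_finRange i, h⟩, rfl⟩), h1⟩

theorem edgeAut_accepts_two (b : ℕ) :
    edgeAut.Accepts 2 (convolution ![[], List.replicate b 0]) := by
  induction b with
  | zero =>
    rw [List.replicate_zero, convolution_nil_nil]
    exact List.mem_cons_self
  | succ b ih =>
    rw [List.replicate_succ, convolution_nil_cons]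
    exact (Automaton.accepts_cons_iff (r := 2) (by decide)).2 ih

theorem edgeAut_accepts_one_iff {a b : ℕ} : edgeAut.Accepts 1
    (convolution ![List.replicate a 0, List.replicate b 0]) ↔ a < b := by
  induction a generalizing b with
  | zero =>
    rcases b with _ | b
    · rw [List.replicate_zero, convolution_nil_nil, Automaton.accepts_nil_iff]
      exact iff_of_false (by decide) (lt_irrefl 0)
    · rw [List.replicate_zero, List.replicate_succ, convolution_nil_cons]
      exact iff_of_true ((Automaton.accepts_cons_iff (r := 2) (by decide)).2
        (edgeAut_accepts_two b)) b.succ_pos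
  | succ a ih =>
    rcases b with _ | b
    · rw [List.replicate_zero, List.replicate_succ, convolution_cons_nil]
      exact iff_of_false (Automaton.not_accepts_cons (by decide)) (Nat.not_lt_zero _)
    · rw [List.replicate_succ, List.replicate_succ, convolution_cons_cons]
      exact (Automaton.accepts_cons_iff (r := 1) (by decide)).trans
        (ih.trans Nat.succ_lt_succ_iff.symm)

theorem edgeAut_accepts_three_iff {a b : ℕ} : edgeAut.Accepts 3
    (convolution ![List.replicate a 0, List.replicate b 0]) ↔ a = b := by
  induction a generalizing b with
  | zero =>
    rcases b with _ | b
    · rw [List.replicate_zero, convolution_nil_nil, Automaton.accepts_nil_iff]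
      exact iff_of_true (by decide) rfl
    · rw [List.replicate_zero, List.replicate_succ, convolution_nil_cons]
      exact iff_of_false (Automaton.not_accepts_cons (by decide)) b.succ_ne_zero.symm
  | succ a ih =>
    rcases b with _ | b
    · rw [List.replicate_zero, List.replicate_succ, convolution_cons_nil]
      exact iff_of_false (Automaton.not_accepts_cons (by decide)) a.succ_ne_zero
    · rw [List.replicate_succ, List.replicate_succ, convolution_cons_cons]
      exact (Automaton.accepts_cons_iff (r := 3) (by decide)).trans
        (ih.trans Nat.succ_inj.symm)

theorem mem_edgeAut_iff_accepts {w : List (Fin 2 → Option (Fin 4))} :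
    w ∈ edgeAut.language ↔ edgeAut.Accepts 0 w := by
  rw [Automaton.mem_language_iff]
  exact ⟨fun ⟨q, hq, h⟩ => List.mem_singleton.1 hq ▸ h, fun h => ⟨_, List.mem_singleton.2 rfl, h⟩⟩

theorem mem_edgeAut_zero_iff {a b : ℕ} :
    convolution ![trackWord 0 a, trackWord 0 b] ∈ edgeAut.language ↔ a < b := by
  rw [mem_edgeAut_iff_accepts, trackWord, trackWord, convolution_cons_cons]
  exact (Automaton.accepts_cons_iff (r := 1) (by decide)).trans edgeAut_accepts_one_iff

theorem mem_edgeAut_succ_iff {i : Fin 3} {a b : ℕ} :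
    convolution ![trackWord i.succ a, trackWord 0 b] ∈ edgeAut.language ↔ a = b := by
  rw [mem_edgeAut_iff_accepts, trackWord, trackWord, convolution_cons_cons]
  refine (Automaton.accepts_cons_iff (r := 3) ?_).trans edgeAut_accepts_three_iff
  revert i
  decide

theorem not_mem_edgeAut {i : Fin 3} {a b : ℕ} :
    convolution ![trackWord 0 a, trackWord i.succ b] ∉ edgeAut.language := by
  rw [mem_edgeAut_iff_accepts, trackWord, trackWord, convolution_cons_cons]
  refine Automaton.not_accepts_cons ?_
  revert i
  decide

/-- A single world whose predicates are recognized by the automata above. -/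
def trackPresentation : AutomaticPresentation graphSignature 1 where
  alphabetSize := 4
  numWorlds := 1
  rel _ _ _ := true
  domAut := domainAut
  predAut _ p := match p with
    | (0 : Fin 3) => edgeAut
    | (1 : Fin 3) => markAut 0
    | (2 : Fin 3) => markAut 1
  domain_nonempty := ⟨trackWord 0 0, mem_domainAut_iff.2 ⟨0, 0, rfl⟩⟩

/-- The copy of the number `n` on track `i`. -/
def trackElement (i : Fin 4) (n : ℕ) : trackPresentation.Domain :=
  ⟨trackWord i n, mem_domainAut_iff.2 ⟨i, n, rfl⟩⟩

theorem represents_trackPresentation (w : trackPresentation.model.World) :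
    Represents trackPresentation.model w trackElement (Facts.stage 0) := by
  have h1 : ∀ i n, (fun j => ((![trackElement i n] : Fin 1 → _) j).1) = ![trackWord i n] :=
    fun i n => funext (Fin.forall_fin_one.2 rfl)
  have h2 : ∀ i a j b, (fun k => ((![trackElement i a, trackElement j b] : Fin 2 → _) k).1) =
      ![trackWord i a, trackWord j b] :=
    fun i a j b => funext (Fin.forall_fin_two.2 ⟨rfl, rfl⟩)
  constructor
  · rintro ⟨u, hu⟩
    obtain ⟨i, n, rfl⟩ := mem_domainAut_iff.1 hu
    exact ⟨i, n, rfl⟩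
  · intro i n
    refine Iff.trans ?_ (mem_markAut_iff (j := 0) (i := i) (n := n))
    rw [← h1]
    rfl
  · intro i n
    refine Iff.trans ?_ (mem_markAut_iff (j := 1) (i := i) (n := n))
    rw [← h1]
    rfl
  · intro a b
    refine Iff.trans ?_ (mem_edgeAut_zero_iff (a := a) (b := b))
    rw [← h2]
    rfl
  · intro i a b
    refine Iff.trans ?_ (mem_edgeAut_succ_iff (i := i) (a := a) (b := b))
    rw [← h2]
    rfl
  · intro i a b
    refine iff_of_false ?_ id
    have h := not_mem_edgeAut (i := i) (a := a) (b := b)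
    rw [← h2] at h
    exact h

/-! ### The reduction -/

/-- The planning problem that asks whether the number `k` eventually has a value. -/
def valueInstance (k : ℕ) : Instance where
  sig := graphSignature
  numAgents := 1
  pres := trackPresentation
  action := ruleAction
  world := (0 : Fin 1)
  goal := hasValue k

theorem isPositive_valueInstance (k : ℕ) :
    (valueInstance k).IsPositive ↔ ∃ N m, Facts.stage N 2 k m := by
  have h : ∀ N (h : (trackPresentation.model.iter ruleAction N).World),
      (trackPresentation.model.histories ruleAction).Holds ⟨N, h⟩ (hasValue k) ↔
        ∃ m, Facts.stage N 2 k m := fun N h =>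
    (Represents.iter represents_trackPresentation N h).histories.holds_hasValue
  constructor
  · rintro ⟨⟨N, x⟩, -, hx⟩
    exact ⟨N, (h N x).1 hx⟩
  · rintro ⟨N, hN⟩
    obtain ⟨x⟩ := Represents.nonempty_iter (M := trackPresentation.model) (0 : Fin 1) N
    -- The presented model has a single world, so every history starts from it.
    exact ⟨⟨N, x⟩, Subsingleton.elim (α := Fin 1) _ _, (h N x).2 hN⟩

/-- The code of the formula `ex x φ`, computed from the code of `φ`. -/
def exCode (x c : ℕ) : ℕ :=
  Nat.pair 1 (Nat.pair 3 (Nat.pair x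
    (Nat.pair 1 (Nat.pair 2 (Nat.pair (Formula.code (onTrack 0 x)) c)))))

theorem primrec_natPair_const (a : ℕ) : Primrec (Nat.pair a) :=
  Primrec₂.natPair.comp (Primrec.const a) Primrec.id

theorem primrec_exCode (x : ℕ) : Primrec (exCode x) :=
  (primrec_natPair_const _).comp <| (primrec_natPair_const _).comp <|
    (primrec_natPair_const _).comp <| (primrec_natPair_const _).comp <|
      (primrec_natPair_const _).comp (primrec_natPair_const _)

theorem primrec_code_valueAfter : Primrec fun k => (valueAfter k).code := by
  let step : ℕ → ℕ := fun c => exCode 1 (Nat.pair 2 (Nat.pair (Formula.code (succ 0 1))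
    (exCode 0 (Nat.pair 2 (Nat.pair (Formula.code (eq 0 1)) c)))))
  have hstep : Primrec step :=
    (primrec_exCode 1).comp <| (primrec_natPair_const _).comp <| (primrec_natPair_const _).comp <|
      (primrec_exCode 0).comp <| (primrec_natPair_const _).comp (primrec_natPair_const _)
  refine (Primrec.nat_rec₁ (valueAfter 0).code (hstep.comp Primrec.snd).to₂).of_eq fun k => ?_
  induction k with
  | zero => rfl
  | succ k ih => exact congrArg step ih

theorem computable_code_valueInstance : Computable fun k => (valueInstance k).code := by
  have h : Primrec fun k => (hasValue k).code :=
    (primrec_exCode 0).comp <| (primrec_natPair_const _).comp <|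
      (primrec_natPair_const _).comp primrec_code_valueAfter
  exact (Primrec.encode.comp <| (Primrec.const graphSignature.code).pair <| (Primrec.const 1).pair <|
    (Primrec.const trackPresentation.code).pair <| (Primrec.const ruleAction.code).pair <|
    (Primrec.const 0).pair h).to_comp

theorem DecidableOn.mono {C C' : Set Instance} (hC : C ⊆ C') (h : DecidableOn C') :
    DecidableOn C := by
  obtain ⟨f, hf, h⟩ := h
  exact ⟨f, hf, fun I hI => h I (hC hI)⟩

/-- Deciding a class of instances decides positivity along every computable family in the class. -/
theorem DecidableOn.computablePred {C : Set Instance} (h : DecidableOn C) {I : ℕ → Instance}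
    (hI : Computable fun k => (I k).code) (hC : ∀ k, I k ∈ C) :
    ComputablePred fun k => (I k).IsPositive := by
  classical
  obtain ⟨f, hf, h⟩ := h
  refine ComputablePred.computable_iff.2 ⟨fun k => decide (I k).IsPositive, ?_, by simp⟩
  refine (hf.comp hI).of_eq fun k => Part.eq_some_iff.2 ?_
  by_cases hk : (I k).IsPositive
  · simpa [hk] using (h _ (hC k)).1 hk
  · simpa [hk] using (h _ (hC k)).2 hk

/-- There is a program whose domain is undecidable. -/
theorem exists_code_not_computablePred : ∃ c : Code, ¬ ComputablePred fun n => (c.eval n).Dom := by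
  have hf : Partrec fun n : ℕ => (Denumerable.ofNat Code n).eval 0 :=
    Code.eval_part.comp (Computable.ofNat Code) (Computable.const 0)
  obtain ⟨c, hc⟩ := Code.exists_code.1 (Partrec.nat_iff.1 hf)
  refine ⟨c, fun h => ComputablePred.halting_problem 0 ?_⟩
  obtain ⟨g, hg, h⟩ := ComputablePred.computable_iff.1 h
  refine ComputablePred.computable_iff.2 ⟨fun p => g (Encodable.encode p),
    hg.comp Computable.encode, funext fun p => ?_⟩
  have hp : c.eval (Encodable.encode p) = p.eval 0 := by
    rw [congrFun hc, Denumerable.ofNat_encode]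
  rw [← congrFun h (Encodable.encode p), hp]

end EPP

/-- Epistemic planning with non-modal action models is undecidable, both with the signature and
the number of agents as part of the input and for one fixed signature and a single agent. -/
theorem mainTheorem2 :
    ¬ EPP.DecidableOn EPP.nonModalInstances ∧
      ¬ EPP.DecidableOn
        {I ∈ EPP.nonModalInstances | I.sig = EPP.graphSignature ∧ I.numAgents = 1} := by
  suffices h : ¬ EPP.DecidableOn
      {I ∈ EPP.nonModalInstances | I.sig = EPP.graphSignature ∧ I.numAgents = 1} from
    ⟨fun h' => h (h'.mono (Set.sep_subset _ _)), h⟩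
  intro h
  obtain ⟨c, hc⟩ := EPP.exists_code_not_computablePred
  refine hc ?_
  have hcode : Computable fun n => Nat.pair (EPP.progCode c) n :=
    (EPP.primrec_natPair_const _).to_comp
  have := h.computablePred (EPP.computable_code_valueInstance.comp hcode)
    fun n => ⟨EPP.ruleAction_nonModal, rfl, rfl⟩
  simpa only [EPP.isPositive_valueInstance, EPP.exists_stage_iff] using this
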